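/- Let $\mathfrak K$ be a field and let $\Lambda$ be a finite-dimensional $\mathfrak K$-algebra with Jacobson radical $J$. A module is called uniserial if it has exactly one composition series. Let $m\ge 2$ and suppose that $\Lambda$ is left $m$-multiserial, i.e. for every primitive idempotent $e$ of $\Lambda$ the left ideal $Je$ is a (not necessarily direct) sum of $m$ uniserial submodules, where zero submodules are allowed. Let $U$ be a finitely generated non-projective uniserial left $\Lambda$-module, and let $\alpha(U)$ denote the number of indecomposable direct summands in a decomposition into indecomposables of the middle term $B$ of the almost split sequence $0\to A\to B\to U\to 0$ of finitely generated left $\Lambda$-modules. Then $\alpha(U)\le m$. That is, for every almost split sequence $0\to A\to B\to U\to 0$ ending in $U$ and every decomposition $B=B_1\oplus\dots\oplus B_n$ with all $B_i$ indecomposable, one has $n\le m$. -/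

import Mathlib

universe u

/-- A module is uniserial if it has exactly one composition series. -/
def IsUniserialModule (R M : Type*) [Ring R] [AddCommGroup M] [Module R M] : Prop :=
  ∃! s : CompositionSeries (Submodule R M), s.head = ⊥ ∧ s.last = ⊤

/-- A module is indecomposable if it is nonzero and is not the direct sum of two nonzero
submodules. -/
def IsIndecomposableModule (R M : Type*) [Ring R] [AddCommGroup M] [Module R M] : Prop :=
  Nontrivial M ∧ ∀ N N' : Submodule R M, IsCompl N N' → N = ⊥ ∨ N' = ⊥

/-- A primitive idempotent: a nonzero idempotent that is not the sum of two nonzero orthogonal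
idempotents. -/
def IsPrimitiveIdempotent {R : Type*} [Ring R] (e : R) : Prop :=
  e ≠ 0 ∧ IsIdempotentElem e ∧
    ∀ f g : R, IsIdempotentElem f → IsIdempotentElem g → f * g = 0 → g * f = 0 →
      e = f + g → f = 0 ∨ g = 0

/-- The left ideal `J e = {x * e | x ∈ J}`, where `J` is the Jacobson radical of `R`. -/
def radicalMul {R : Type*} [Ring R] (e : R) : Submodule R R :=
  Submodule.map (LinearMap.toSpanSingleton R R e) (Ring.jacobson R)

/-- `R` is left `m`-multiserial: for each primitive idempotent `e`, the left ideal `J e` is a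
(not necessarily direct) sum of `m` uniserial submodules. As the zero module is uniserial, this
is the same as a sum of at most `m` nonzero uniserial submodules. -/
def IsLeftMultiserial (m : ℕ) (R : Type*) [Ring R] : Prop :=
  ∀ e : R, IsPrimitiveIdempotent e →
    ∃ V : Fin m → Submodule R R, (∀ i, IsUniserialModule R (V i)) ∧ ⨆ i, V i = radicalMul e

/-- `g : B → C` is right almost split in the category of finitely generated left `R`-modules:
it is not a split epimorphism, and each map `X → C` that is not a split epimorphism factors
through `g`. (Each finitely generated `R`-module has an isomorphic copy in the universe of `R`.) -/
def IsRightAlmostSplit {R B C : Type u} [Ring R] [AddCommGroup B] [Module R B]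
    [AddCommGroup C] [Module R C] (g : B →ₗ[R] C) : Prop :=
  (¬ ∃ s : C →ₗ[R] B, g ∘ₗ s = LinearMap.id) ∧
    ∀ (X : Type u) [AddCommGroup X] [Module R X] [Module.Finite R X] (h : X →ₗ[R] C),
      (¬ ∃ s : C →ₗ[R] X, h ∘ₗ s = LinearMap.id) → ∃ k : X →ₗ[R] B, g ∘ₗ k = h

/-- `f : A → B` is left almost split in the category of finitely generated left `R`-modules:
it is not a split monomorphism, and each map `A → X` that is not a split monomorphism factors
through `f`. -/
def IsLeftAlmostSplit {R A B : Type u} [Ring R] [AddCommGroup A] [Module R A]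
    [AddCommGroup B] [Module R B] (f : A →ₗ[R] B) : Prop :=
  (¬ ∃ r : B →ₗ[R] A, r ∘ₗ f = LinearMap.id) ∧
    ∀ (X : Type u) [AddCommGroup X] [Module R X] [Module.Finite R X] (h : A →ₗ[R] X),
      (¬ ∃ r : X →ₗ[R] A, r ∘ₗ h = LinearMap.id) → ∃ k : B →ₗ[R] X, k ∘ₗ f = h

/-- `0 → A → B → C → 0` is an almost split sequence of left `R`-modules (to be used for finitely
generated `A`, `B`, `C`): it is exact, `f` is left almost split and `g` is right almost split. -/
structure IsAlmostSplitSequence {R A B C : Type u} [Ring R] [AddCommGroup A] [Module R A]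
    [AddCommGroup B] [Module R B] [AddCommGroup C] [Module R C]
    (f : A →ₗ[R] B) (g : B →ₗ[R] C) : Prop where
  injective : Function.Injective f
  exact : Function.Exact f g
  surjective : Function.Surjective g
  left_almost_split : IsLeftAlmostSplit f
  right_almost_split : IsRightAlmostSplit g

/-! Every nonzero summand of `B` contains a simple submodule, so it suffices to bound the socle of
`B`; indecomposability enters only through nonvanishing. Write `U = P / V` with `P = Λe`, `e`
primitive, and `Je = ∑ W i` with every `W i` a chain (its submodules are linearly ordered). For `S`
simple, `finrank_hom_left_le` gives dim Hom(S, A) ≤ dim Hom(V, S), so the top of `V` controls the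
socle of `A`. If `W i₁` has the largest image in the chain `U`, then `V + W i₁ = Je`, and
`finrank_hom_le_sum_of_sup_eq_iSup` bounds the top of `V` by the tops of the `m` chains `V ∩ W i₁`
and `W i`, `i ≠ i₁`. As `U` adds at most one simple, the socle of `B` has length at most `m + 1`.

The surplus 1 is removed in three cases. If `U` is simple, no simple submodule of `B` maps onto it.
If `V ≤ W i₁`, then `V` is itself a chain and the bound is `2 ≤ m`. Otherwise there is a maximal
submodule `V'` of `V` containing `V ∩ W i₁`; `P / V'` embeds into a single summand
(`exists_injective_to_summand`) and contains the independent nonzero images of `V` and `W i₁`. That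
summand has two independent simples, so `n + 1 ≤ m + 1`. -/

/-- The submodules of `M` are linearly ordered by inclusion. -/
def HasTotalSubmodules (R M : Type*) [Ring R] [AddCommGroup M] [Module R M] : Prop :=
  ∀ X Y : Submodule R M, X ≤ Y ∨ Y ≤ X

/-! ### Chains of submodules and their simple tops and socles -/

section Chains

variable {R M N : Type*} [Ring R] [AddCommGroup M] [Module R M] [AddCommGroup N] [Module R N]

theorem exists_compositionSeries_of_le [IsNoetherian R M] [IsArtinian R M] {X Y : Submodule R M}
    (h : X ≤ Y) : ∃ s : CompositionSeries (Submodule R M), s.head = X ∧ s.last = Y := by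
  induction Y using WellFoundedLT.induction with
  | ind Y ih =>
    rcases h.eq_or_lt with rfl | h
    · exact ⟨RelSeries.singleton _ X, rfl, rfl⟩
    · obtain ⟨Z, hXZ, hZY⟩ := exists_le_covBy_of_lt h
      obtain ⟨s, hs, hs'⟩ := ih Z hZY.lt hXZ
      refine ⟨s.snoc Y ?_, ?_, ?_⟩
      · rw [hs']; exact hZY
      · simpa using hs
      · simp

/-- Any submodule can be placed in some composition series, hence lies in the unique one, whose
members are pairwise comparable. -/
theorem IsUniserialModule.hasTotalSubmodules [IsNoetherian R M] [IsArtinian R M]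
    (h : IsUniserialModule R M) : HasTotalSubmodules R M := by
  obtain ⟨s, -, hs⟩ := h
  have key (X : Submodule R M) : X ∈ s := by
    obtain ⟨p, hp, hp'⟩ := exists_compositionSeries_of_le (bot_le : ⊥ ≤ X)
    obtain ⟨q, hq, hq'⟩ := exists_compositionSeries_of_le (le_top : X ≤ ⊤)
    have hpq : p.last = q.head := hp'.trans hq.symm
    have := hs (p.smash q hpq) ⟨by simpa using hp, by simpa using hq'⟩
    rw [← this]
    exact ⟨_, (RelSeries.smash_castLE hpq (Fin.last p.length)).trans hp'⟩
  exact fun X Y => CompositionSeries.total (key X) (key Y)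

theorem HasTotalSubmodules.of_injective (h : HasTotalSubmodules R M) (f : N →ₗ[R] M)
    (hf : Function.Injective f) : HasTotalSubmodules R N := fun X Y => by
  simpa only [Submodule.map_le_map_iff_of_injective hf] using h (X.map f) (Y.map f)

theorem HasTotalSubmodules.exists_forall_le {ι : Type*} [Finite ι] [Nonempty ι]
    (h : HasTotalSubmodules R M) (X : ι → Submodule R M) : ∃ i, ∀ j, X j ≤ X i := by
  obtain ⟨_, ⟨i, rfl⟩, hi⟩ := (Set.finite_range X).exists_maximal (Set.range_nonempty X)
  exact ⟨i, fun j => (h (X j) (X i)).elim id fun hij => hi ⟨j, rfl⟩ hij⟩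

variable {S S' : Type*} [AddCommGroup S] [Module R S] [AddCommGroup S'] [Module R S']

/-- Both kernels are maximal submodules, and comparable maximal submodules coincide. -/
theorem HasTotalSubmodules.ker_eq_ker [IsSimpleModule R S] [IsSimpleModule R S']
    (h : HasTotalSubmodules R M) {p : M →ₗ[R] S} {q : M →ₗ[R] S'} (hp : p ≠ 0) (hq : q ≠ 0) :
    LinearMap.ker p = LinearMap.ker q := by
  have hp' := LinearMap.isCoatom_ker_of_surjective (LinearMap.surjective_of_ne_zero hp)
  have hq' := LinearMap.isCoatom_ker_of_surjective (LinearMap.surjective_of_ne_zero hq)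
  rcases h (LinearMap.ker p) (LinearMap.ker q) with hle | hle
  · exact ((hp'.le_iff.1 hle).resolve_left hq'.1).symm
  · exact (hq'.le_iff.1 hle).resolve_left hp'.1

theorem HasTotalSubmodules.range_eq_range [IsSimpleModule R S] [IsSimpleModule R S']
    (h : HasTotalSubmodules R M) {p : S →ₗ[R] M} {q : S' →ₗ[R] M} (hp : p ≠ 0) (hq : q ≠ 0) :
    LinearMap.range p = LinearMap.range q := by
  have hp' : IsAtom (LinearMap.range p) := isSimpleModule_iff_isAtom.1 <|
    .congr (LinearEquiv.ofInjective p (LinearMap.injective_of_ne_zero hp)).symm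
  have hq' : IsAtom (LinearMap.range q) := isSimpleModule_iff_isAtom.1 <|
    .congr (LinearEquiv.ofInjective q (LinearMap.injective_of_ne_zero hq)).symm
  rcases h (LinearMap.range p) (LinearMap.range q) with hle | hle
  · exact (hq'.le_iff.1 hle).resolve_left hp'.1
  · exact ((hp'.le_iff.1 hle).resolve_left hq'.1).symm

theorem HasTotalSubmodules.nonempty_equiv_of_hom_to [IsSimpleModule R S] [IsSimpleModule R S']
    (h : HasTotalSubmodules R M) {p : M →ₗ[R] S} {q : M →ₗ[R] S'} (hp : p ≠ 0) (hq : q ≠ 0) :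
    Nonempty (S ≃ₗ[R] S') :=
  ⟨(p.quotKerEquivOfSurjective (LinearMap.surjective_of_ne_zero hp)).symm ≪≫ₗ
    Submodule.quotEquivOfEq _ _ (h.ker_eq_ker hp hq) ≪≫ₗ
    q.quotKerEquivOfSurjective (LinearMap.surjective_of_ne_zero hq)⟩

theorem HasTotalSubmodules.nonempty_equiv_of_hom_from [IsSimpleModule R S] [IsSimpleModule R S']
    (h : HasTotalSubmodules R M) {p : S →ₗ[R] M} {q : S' →ₗ[R] M} (hp : p ≠ 0) (hq : q ≠ 0) :
    Nonempty (S ≃ₗ[R] S') :=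
  ⟨LinearEquiv.ofInjective p (LinearMap.injective_of_ne_zero hp) ≪≫ₗ
    LinearEquiv.ofEq _ _ (h.range_eq_range hp hq) ≪≫ₗ
    (LinearEquiv.ofInjective q (LinearMap.injective_of_ne_zero hq)).symm⟩

end Chains

/-! ### Counting simples by dimensions of Hom spaces -/

section HomDimensions

variable (K : Type*) {R M S : Type*} [Field K] [Ring R] [Algebra K R]
  [AddCommGroup M] [Module R M] [AddCommGroup S] [Module R S] [Module K S] [IsScalarTower K R S]

theorem finite_hom {M N : Type*} [AddCommGroup M] [Module R M] [Module K M] [IsScalarTower K R M]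
    [AddCommGroup N] [Module R N] [Module K N] [IsScalarTower K R N]
    [Module.Finite K M] [Module.Finite K N] : Module.Finite K (M →ₗ[R] N) :=
  Module.Finite.of_injective (LinearMap.restrictScalarsₗ K R M N K)
    (LinearMap.restrictScalars_injective K)

/-- All nonzero maps to `S` share a kernel, so each one is a fixed one followed by an endomorphism
of `S`. -/
theorem HasTotalSubmodules.finrank_hom_to_le [IsSimpleModule R S] [Module.Finite K S]
    (h : HasTotalSubmodules R M) :
    Module.finrank K (M →ₗ[R] S) ≤ Module.finrank K (S →ₗ[R] S) := by
  have := finite_hom K (R := R) (M := S) (N := S)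
  by_cases h0 : ∃ p : M →ₗ[R] S, p ≠ 0
  · obtain ⟨p, hp⟩ := h0
    have hs := LinearMap.surjective_of_ne_zero hp
    refine LinearMap.finrank_le_finrank_of_surjective
      (f := (LinearMap.lcomp K S p : (S →ₗ[R] S) →ₗ[K] (M →ₗ[R] S))) fun q => ?_
    by_cases hq : q = 0
    · exact ⟨0, by simp [hq]⟩
    · refine ⟨(LinearMap.ker p).liftQ q (h.ker_eq_ker hp hq).le ∘ₗ
        (p.quotKerEquivOfSurjective hs).symm.toLinearMap, ?_⟩
      ext x
      have : (p.quotKerEquivOfSurjective hs).symm (p x) = (LinearMap.ker p).mkQ x := by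
        rw [LinearEquiv.symm_apply_eq]; simp
      simp [this]
  · push Not at h0
    have : Subsingleton (M →ₗ[R] S) := ⟨fun a b => by rw [h0 a, h0 b]⟩
    simp [Module.finrank_zero_of_subsingleton]

variable [Module K M] [IsScalarTower K R M]

theorem finite_submodule [Module.Finite K M] (X : Submodule R M) : Module.Finite K X :=
  Module.Finite.of_injective (X.subtype.restrictScalars K) X.subtype_injective

theorem HasTotalSubmodules.finrank_hom_from_le [IsSimpleModule R S] [Module.Finite K S]
    (h : HasTotalSubmodules R M) :
    Module.finrank K (S →ₗ[R] M) ≤ Module.finrank K (S →ₗ[R] S) := by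
  have := finite_hom K (R := R) (M := S) (N := S)
  by_cases h0 : ∃ p : S →ₗ[R] M, p ≠ 0
  · obtain ⟨p, hp⟩ := h0
    have hs := LinearMap.injective_of_ne_zero hp
    refine LinearMap.finrank_le_finrank_of_surjective
      (f := (LinearMap.compRight K p : (S →ₗ[R] S) →ₗ[K] (S →ₗ[R] M))) fun q => ?_
    by_cases hq : q = 0
    · exact ⟨0, by simp [hq]⟩
    · refine ⟨(LinearEquiv.ofInjective p hs).symm.toLinearMap ∘ₗ
        q.codRestrict _ fun x => (h.range_eq_range hp hq).ge ⟨x, rfl⟩, ?_⟩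
      ext x
      have : p ((LinearEquiv.ofInjective p hs).symm
          ⟨q x, (h.range_eq_range hp hq).ge ⟨x, rfl⟩⟩) = q x :=
        congrArg Subtype.val ((LinearEquiv.ofInjective p hs).apply_symm_apply
          ⟨q x, (h.range_eq_range hp hq).ge ⟨x, rfl⟩⟩)
      exact this
  · push Not at h0
    have : Subsingleton (S →ₗ[R] M) := ⟨fun a b => by rw [h0 a, h0 b]⟩
    simp [Module.finrank_zero_of_subsingleton]

theorem card_mul_finrank_end_le_of_iSupIndep {κ : Type*} [Module.Finite K S]
    [Module.Finite K M] (σ : κ → Submodule R M) (hσ : iSupIndep σ) (T : Finset κ)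
    (hT : ∀ k ∈ T, Nonempty (S ≃ₗ[R] σ k)) :
    T.card * Module.finrank K (S →ₗ[R] S) ≤ Module.finrank K (S →ₗ[R] M) := by
  classical
  have := finite_hom K (R := R) (M := S) (N := S)
  have := finite_hom K (R := R) (M := S) (N := M)
  let F : (T → (S →ₗ[R] S)) →ₗ[K] (S →ₗ[R] M) :=
    ∑ t : T, (LinearMap.compRight K ((σ t).subtype ∘ₗ (hT t t.2).some.toLinearMap)) ∘ₗ
      LinearMap.proj t
  have hF (e : T → (S →ₗ[R] S)) (x : S) :
      F e x = ∑ t : T, (((hT t t.2).some (e t x) : σ t) : M) := by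
    simp [F, LinearMap.sum_apply]
  have hinj : Function.Injective F := by
    refine (injective_iff_map_eq_zero F).2 fun e he => ?_
    ext t x
    have hsum : ∑ k ∈ T.attach, (((hT k k.2).some (e k x) : σ k) : M) = 0 := by
      have := hF e x
      rw [he] at this
      simpa using this.symm
    have := (iSupIndep_iff_finsetSum_eq_zero_imp_eq_zero _).1
      (hσ.comp (f := ((↑) : T → κ)) Subtype.val_injective) T.attach _
      (fun k _ => Subtype.coe_prop _) hsum t (Finset.mem_attach _ _)
    simpa using this
  calc _ = Module.finrank K (T → (S →ₗ[R] S)) := by simp [Module.finrank_pi_fintype]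
    _ ≤ _ := LinearMap.finrank_le_finrank_of_injective hinj

/-- Counting independent simple submodules through dimensions of spaces of homomorphisms. -/
theorem card_le_card_of_finrank_hom_le {κ ι : Type*} [Fintype κ] [Fintype ι]
    [Module.Finite K M]
    (σ : κ → Submodule R M) (hσ : iSupIndep σ) (hsimple : ∀ k, IsSimpleModule R (σ k))
    (δ : κ → ι → ℕ)
    (hle : ∀ k, Module.finrank K (σ k →ₗ[R] M) ≤ ∑ i, δ k i)
    (hδ : ∀ k i, δ k i ≤ Module.finrank K (σ k →ₗ[R] σ k))
    (hiso : ∀ k k' i, δ k i ≠ 0 → δ k' i ≠ 0 → Nonempty (σ k ≃ₗ[R] σ k')) :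
    Fintype.card κ ≤ Fintype.card ι := by
  classical
  let s : Setoid κ := ⟨fun k k' => Nonempty (σ k ≃ₗ[R] σ k'),
    fun k => ⟨.refl R _⟩, fun ⟨a⟩ => ⟨a.symm⟩, fun ⟨a⟩ ⟨b⟩ => ⟨a ≪≫ₗ b⟩⟩
  -- `F c` collects the indices that contribute to the isomorphism class `c`. By `hiso` an index
  -- serves only one class, so these sets are disjoint and the bounds for the classes add up.
  let F (c : Quotient s) : Finset ι := Finset.univ.filter fun i => δ c.out i ≠ 0
  have hF (c : Quotient s) :
      (Finset.univ.filter fun k => Quotient.mk s k = c).card ≤ (F c).card := by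
    have := hsimple c.out
    have := finite_submodule K (σ c.out)
    have hfin := finite_hom K (R := R) (M := σ c.out) (N := σ c.out)
    have hpos : 0 < Module.finrank K (σ c.out →ₗ[R] σ c.out) := by
      have : Nontrivial (σ c.out) := IsSimpleModule.nontrivial R _
      have : Nontrivial (σ c.out →ₗ[R] σ c.out) := inferInstanceAs (Nontrivial (Module.End R _))
      exact Module.finrank_pos
    refine Nat.le_of_mul_le_mul_right ?_ hpos
    calc _ ≤ Module.finrank K (σ c.out →ₗ[R] M) :=
          card_mul_finrank_end_le_of_iSupIndep K σ hσ _ fun k hk => by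
            refine Quotient.exact (s := s) ?_
            simpa using (Finset.mem_filter.1 hk).2.symm
      _ ≤ ∑ i, δ c.out i := hle _
      _ = ∑ i ∈ F c, δ c.out i := by
          rw [Finset.sum_filter_ne_zero]
      _ ≤ _ := Finset.sum_le_card_nsmul _ _ _ fun i _ => hδ _ i
  have hdisj : ((Finset.univ : Finset (Quotient s)) : Set (Quotient s)).PairwiseDisjoint F := by
    intro c _ d _ hcd
    refine Finset.disjoint_left.2 fun i hi hj => hcd ?_
    rw [← c.out_eq, ← d.out_eq]
    exact Quotient.sound (hiso _ _ i (Finset.mem_filter.1 hi).2 (Finset.mem_filter.1 hj).2)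
  calc Fintype.card κ
      = ∑ c : Quotient s, (Finset.univ.filter fun k => Quotient.mk s k = c).card :=
        Finset.card_eq_sum_card_fiberwise fun _ _ => Finset.mem_univ _
    _ ≤ ∑ c : Quotient s, (F c).card := Finset.sum_le_sum fun c _ => hF c
    _ = (Finset.univ.biUnion F).card := (Finset.card_biUnion hdisj).symm
    _ ≤ Fintype.card ι := Finset.card_le_univ _

end HomDimensions

/-! ### Primitive idempotents and local projectives -/

section Idempotents

variable {R : Type*} [Ring R]

/-- Fitting's lemma for right multiplication by `a`: the component of `1` in the stable range is the
idempotent. -/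
theorem exists_isIdempotentElem_mem_of_not_isNilpotent [IsArtinianRing R] {I : Ideal R} {a : R}
    (ha : a ∈ I) (hnil : ¬ IsNilpotent a) : ∃ f ∈ I, IsIdempotentElem f ∧ f ≠ 0 := by
  let ρ : Module.End R R := LinearMap.toSpanSingleton R R a
  have hρ (k : ℕ) (x : R) : (ρ ^ k) x = x * a ^ k := by
    induction k generalizing x with
    | zero => simp
    | succ k ih => rw [pow_succ, Module.End.mul_apply, ih, pow_succ']; simp [ρ, mul_assoc]
  obtain ⟨k, hk⟩ := Filter.eventually_atTop.1 ρ.eventually_isCompl_ker_pow_range_pow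
  -- The exponent is `k + 1` so that the range consists of multiples of `a` and hence lies in `I`.
  have hc := hk (k + 1) (Nat.le_succ k)
  obtain ⟨p, hp, q, hq, hpq⟩ := Submodule.mem_sup.1
    (hc.sup_eq_top.symm ▸ Submodule.mem_top : (1 : R) ∈ _)
  have hpq0 : p * q = 0 := by
    refine Submodule.disjoint_def.1 hc.disjoint _ ?_ (Submodule.smul_mem _ p hq)
    have : p * q = p - p * p := by rw [← mul_one_sub, ← hpq]; congr 1; abel
    rw [this]
    exact Submodule.sub_mem _ hp (Submodule.smul_mem _ p hp)
  refine ⟨q, ?_, ?_, ?_⟩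
  · obtain ⟨c, rfl⟩ := hq
    rw [hρ, pow_succ, ← mul_assoc]
    exact I.mul_mem_left _ ha
  · have : (p + q) * q = q := by rw [hpq, one_mul]
    rwa [add_mul, hpq0, zero_add] at this
  · rintro rfl
    rw [add_zero] at hpq
    subst hpq
    rw [LinearMap.mem_ker, hρ, one_mul] at hp
    exact hnil ⟨_, hp⟩

theorem exists_not_isNilpotent_mul_of_notMem_jacobson {x : R} (hx : x ∉ Ring.jacobson R) :
    ∃ r, ¬ IsNilpotent (r * x) := by
  by_contra! h
  refine hx ?_
  rw [← Ideal.jacobson_bot, Ideal.mem_jacobson_iff]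
  intro y
  obtain ⟨w, hw⟩ := (h y).isUnit_one_add
  refine ⟨↑w⁻¹, ?_⟩
  have : (↑w⁻¹ : R) * (1 + y * x) = 1 := by rw [← hw]; simp
  rw [Ideal.mem_bot, ← this]
  noncomm_ring

/-- This makes `Re` local. Outside the radical, `X` contains a nonzero idempotent `f` with `fe = f`;
primitivity applied to `e = ef + (e - ef)` leaves only `e = ef`. -/
theorem IsPrimitiveIdempotent.mem_of_not_le_radicalMul [IsArtinianRing R] {e : R}
    (he : IsPrimitiveIdempotent e) {X : Ideal R} (hX : X ≤ Submodule.span R {e})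
    (hXJ : ¬ X ≤ radicalMul e) : e ∈ X := by
  obtain ⟨x, hx, hxJ⟩ := SetLike.not_le_iff_exists.1 hXJ
  have mul_e {y : R} (hy : y ∈ X) : y * e = y := by
    obtain ⟨c, rfl⟩ := Submodule.mem_span_singleton.1 (hX hy)
    rw [smul_eq_mul, mul_assoc, he.2.1]
  have hxJ' : x ∉ Ring.jacobson R := fun h => hxJ ⟨x, h, by simp [mul_e hx]⟩
  obtain ⟨r, hr⟩ := exists_not_isNilpotent_mul_of_notMem_jacobson hxJ'
  obtain ⟨f, hf, hff, hf0⟩ :=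
    exists_isIdempotentElem_mem_of_not_isNilpotent (X.mul_mem_left r hx) hr
  have hfe := mul_e hf
  have hee : e * e = e := he.2.1
  have hff' : f * f = f := hff
  have h1 : (e * f) * (e * f) = e * f := by
    rw [mul_assoc, ← mul_assoc f e f, hfe, hff']
  have h2 : e * (e * f) = e * f := by rw [← mul_assoc, hee]
  have h3 : (e * f) * e = e * f := by rw [mul_assoc, hfe]
  rcases he.2.2 (e * f) (e - e * f) h1
    (by change (e - e * f) * (e - e * f) = _; simp only [sub_mul, mul_sub, h1, h2, h3, hee]; abel)
    (by rw [mul_sub, h3, h1, sub_self]) (by rw [sub_mul, h2, h1, sub_self]) (by abel) with h | h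
  · refine absurd ?_ hf0
    rw [← hff', ← hfe, mul_assoc, hfe, h, mul_zero]
  · rw [sub_eq_zero.1 h]
    exact X.mul_mem_left e hf

/-- Take `Re` minimal among idempotents not killing `U / M`. If `e = f + g`, one part also does not
kill it, and minimality makes the other part zero. -/
theorem exists_isPrimitiveIdempotent_smul_notMem [IsArtinianRing R] {U : Type*} [AddCommGroup U]
    [Module R U] {M : Submodule R U} (hM : M ≠ ⊤) :
    ∃ e : R, IsPrimitiveIdempotent e ∧ ∃ u : U, e • u ∉ M := by
  let s : Set (Ideal R) :=
    {I | ∃ e : R, IsIdempotentElem e ∧ (∃ u : U, e • u ∉ M) ∧ I = Submodule.span R {e}}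
  have hs : s.Nonempty := by
    obtain ⟨u, -, hu⟩ := SetLike.exists_of_lt (lt_top_iff_ne_top.2 hM)
    exact ⟨_, 1, IsIdempotentElem.one, ⟨u, by simpa using hu⟩, rfl⟩
  obtain ⟨I, ⟨e, he, ⟨u, hu⟩, rfl⟩, hmin⟩ := WellFounded.has_min wellFounded_lt s hs
  have key (f g : R) (hf : IsIdempotentElem f) (hfg : f * g = 0) (hgf : g * f = 0)
      (hefg : e = f + g) (hfu : f • u ∉ M) : g = 0 := by
    have hfe : f * e = f := by rw [hefg, mul_add, hf, hfg, add_zero]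
    have hef : e * f = f := by rw [hefg, add_mul, hf, hgf, add_zero]
    have hle : Submodule.span R {f} ≤ Submodule.span R {e} := by
      rw [Submodule.span_singleton_le_iff_mem, Submodule.mem_span_singleton]
      exact ⟨f, hfe⟩
    have hmem : e ∈ Submodule.span R {f} := by
      have := hle.lt_or_eq.resolve_left (hmin _ ⟨f, hf, ⟨u, hfu⟩, rfl⟩)
      rw [this]
      exact Submodule.mem_span_singleton_self e
    obtain ⟨c, hc⟩ := Submodule.mem_span_singleton.1 hmem
    have : e * f = e := by rw [← hc, smul_eq_mul, mul_assoc, hf]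
    rw [hef] at this
    rw [this] at hefg
    simpa using hefg
  refine ⟨e, ⟨?_, he, fun f g hf hg hfg hgf hefg => ?_⟩, u, hu⟩
  · rintro rfl
    simp at hu
  · by_cases hfu : f • u ∈ M
    · refine Or.inl (key g f hg hgf hfg (by rw [hefg, add_comm]) fun hgu => hu ?_)
      rw [hefg, add_smul]
      exact M.add_mem hfu hgu
    · exact Or.inr (key f g hf hfg hgf hefg hfu)

theorem IsIdempotentElem.projective_span_singleton {e : R} (he : IsIdempotentElem e) :
    Module.Projective R (Submodule.span R {e} : Submodule R R) := by
  have hee : e * e = e := he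
  refine Module.Projective.of_split (M := R) (Submodule.subtype _)
    ((LinearMap.toSpanSingleton R R e).codRestrict _ fun x =>
      Submodule.mem_span_singleton.2 ⟨x, rfl⟩) ?_
  ext ⟨x, hx⟩
  obtain ⟨c, rfl⟩ := Submodule.mem_span_singleton.1 hx
  simp [mul_assoc, hee]

/-- A nonzero finitely generated module with linearly ordered submodules is a quotient of `R e`
for a primitive idempotent `e`. -/
theorem HasTotalSubmodules.exists_isPrimitiveIdempotent_surjective [IsArtinianRing R] {U : Type*}
    [AddCommGroup U] [Module R U] [Module.Finite R U] [Nontrivial U]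
    (hU : HasTotalSubmodules R U) :
    ∃ e : R, IsPrimitiveIdempotent e ∧
      ∃ p : (Submodule.span R {e} : Submodule R R) →ₗ[R] U, Function.Surjective p := by
  obtain ⟨M, hM, -⟩ := (eq_top_or_exists_le_coatom (⊥ : Submodule R U)).resolve_left bot_ne_top
  obtain ⟨e, he, u, hu⟩ := exists_isPrimitiveIdempotent_smul_notMem hM.1
  refine ⟨e, he, LinearMap.toSpanSingleton R U u ∘ₗ Submodule.subtype _, ?_⟩
  rw [← LinearMap.range_eq_top]
  -- The image is not inside the maximal submodule `M`, so it contains `M` by comparability and is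
  -- everything.
  refine (hM.le_iff.1 ?_).resolve_right fun h => hu ?_
  · refine (hU M _).resolve_right fun h => hu (h ?_)
    exact ⟨⟨e, Submodule.mem_span_singleton_self e⟩, rfl⟩
  · rw [← h]
    exact ⟨⟨e, Submodule.mem_span_singleton_self e⟩, rfl⟩

end Idempotents

theorem exists_comp_eq_of_forall_mem_range {R A B S : Type*} [Ring R] [AddCommGroup A] [Module R A]
    [AddCommGroup B] [Module R B] [AddCommGroup S] [Module R S] {f : A →ₗ[R] B}
    (hf : Function.Injective f) (q : S →ₗ[R] B) (hq : ∀ s, q s ∈ LinearMap.range f) :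
    ∃ r : S →ₗ[R] A, f ∘ₗ r = q := by
  refine ⟨(LinearEquiv.ofInjective f hf).symm.toLinearMap ∘ₗ q.codRestrict _ hq, ?_⟩
  ext s
  exact congrArg Subtype.val ((LinearEquiv.ofInjective f hf).apply_symm_apply ⟨q s, hq s⟩)

/-! ### Socle estimates from the almost split sequence -/

section AlmostSplit

variable (K : Type*) {R : Type u} [Field K] [Ring R] [Algebra K R]
  {P U A B : Type u} [AddCommGroup P] [Module R P] [AddCommGroup U] [Module R U]
  [AddCommGroup A] [Module R A] [AddCommGroup B] [Module R B]
  {f : A →ₗ[R] B} {g : B →ₗ[R] U}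

/-- The pushout description of an almost split sequence: up to maps that extend to the projective
module `P`, the connecting map on the kernel of `P → U` factors through each simple submodule of
the left-hand term. -/
theorem IsAlmostSplitSequence.exists_hom_ker [Module.Projective R P] [Module.Finite R A]
    (h : IsAlmostSplitSequence f g) {p : P →ₗ[R] U} (hp : Function.Surjective p) :
    ∃ θ : LinearMap.ker p →ₗ[R] A, (¬ ∃ ρ : P →ₗ[R] A, ρ ∘ₗ (LinearMap.ker p).subtype = θ) ∧
      ∀ {S : Type*} [AddCommGroup S] [Module R S] [IsSimpleModule R S] (j : S →ₗ[R] A), j ≠ 0 →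
        ∃ (ξ : LinearMap.ker p →ₗ[R] S) (ρ : P →ₗ[R] A),
          θ = j ∘ₗ ξ + ρ ∘ₗ (LinearMap.ker p).subtype := by
  obtain ⟨β, hβ⟩ := Module.projective_lifting_property g p h.surjective
  have hβ' (x : P) : g (β x) = p x := LinearMap.congr_fun hβ x
  obtain ⟨θ, hθ⟩ := exists_comp_eq_of_forall_mem_range h.injective
    (β ∘ₗ (LinearMap.ker p).subtype) fun v => (h.exact _).1 ((hβ' v).trans v.2)
  replace hθ (v : LinearMap.ker p) : f (θ v) = β v := LinearMap.congr_fun hθ v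
  refine ⟨θ, ?_, ?_⟩
  -- An extension `ρ` of `θ` would let `β - fρ` descend to `U` and split `g`.
  · rintro ⟨ρ, hρ⟩
    refine h.right_almost_split.1 ⟨(LinearMap.ker p).liftQ (β - f ∘ₗ ρ) ?_ ∘ₗ
      (p.quotKerEquivOfSurjective hp).symm.toLinearMap, ?_⟩
    · intro v hv
      have : ρ v = θ ⟨v, hv⟩ := LinearMap.congr_fun hρ ⟨v, hv⟩
      simp [this, hθ]
    · ext y
      obtain ⟨x, rfl⟩ := hp y
      have : (p.quotKerEquivOfSurjective hp).symm (p x) = (LinearMap.ker p).mkQ x := by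
        rw [LinearEquiv.symm_apply_eq]; simp
      have hgf (a : A) : g (f a) = 0 := (h.exact _).2 ⟨a, rfl⟩
      simp [this, hβ', hgf]
  · intro S _ _ _ j hj
    have hinj := LinearMap.injective_of_ne_zero hj
    -- Passing to `A / j(S)` is not a split mono, so it extends over `B`; lifting `kβ` to `A`
    -- corrects `θ` to land in `j(S)`.
    obtain ⟨k, hk⟩ := h.left_almost_split.2 (A ⧸ LinearMap.range j) (LinearMap.range j).mkQ (by
      rintro ⟨r, hr⟩
      refine hj (LinearMap.ext fun s => ?_)
      have := LinearMap.congr_fun hr (j s)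
      have h0 : (LinearMap.range j).mkQ (j s) = 0 := by simp
      rw [LinearMap.comp_apply, h0, map_zero] at this
      exact this.symm)
    obtain ⟨ρ, hρ⟩ := Module.projective_lifting_property (LinearMap.range j).mkQ (k ∘ₗ β)
      (Submodule.mkQ_surjective _)
    have hξ (v : LinearMap.ker p) :
        (θ - ρ ∘ₗ (LinearMap.ker p).subtype) v ∈ LinearMap.range j := by
      rw [← Submodule.ker_mkQ (LinearMap.range j), LinearMap.mem_ker]
      have h1 := LinearMap.congr_fun hk (θ v)
      have h2 := LinearMap.congr_fun hρ v
      simp only [LinearMap.comp_apply, hθ] at h1 h2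
      simp only [LinearMap.sub_apply, LinearMap.comp_apply, map_sub, Submodule.subtype_apply]
      rw [← h1, h2, sub_self]
    obtain ⟨ξ, hξ'⟩ := exists_comp_eq_of_forall_mem_range hinj _ hξ
    exact ⟨ξ, ρ, by rw [hξ', sub_add_cancel]⟩

variable [Module K P] [IsScalarTower K R P] [Module K A] [IsScalarTower K R A]
  {S : Type*} [AddCommGroup S] [Module R S] [Module K S] [IsScalarTower K R S]

/-- A functional `φ` that vanishes on maps extending to `P` but not at `θ` gives the pairing `(j, ξ)
↦ φ(jξ)`. It is nondegenerate in `j`, because `θ` factors through any nonzero `j` up to an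
extendable map. -/
theorem IsAlmostSplitSequence.finrank_hom_left_le [Module.Projective R P] [Module.Finite K P]
    [Module.Finite R A]
    [Module.Finite K S] [IsSimpleModule R S]
    (h : IsAlmostSplitSequence f g) {p : P →ₗ[R] U} (hp : Function.Surjective p) :
    Module.finrank K (S →ₗ[R] A) ≤ Module.finrank K (LinearMap.ker p →ₗ[R] S) := by
  obtain ⟨θ, hθ, hξ⟩ := h.exists_hom_ker hp
  have := finite_submodule K (LinearMap.ker p)
  have := finite_hom K (R := R) (M := LinearMap.ker p) (N := S)
  let res : (P →ₗ[R] A) →ₗ[K] (LinearMap.ker p →ₗ[R] A) :=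
    LinearMap.lcomp K A (LinearMap.ker p).subtype
  obtain ⟨φ, hφ, hφres⟩ := Submodule.exists_dual_map_eq_bot_of_notMem (p := LinearMap.range res)
    (x := θ) (by rintro ⟨ρ, hρ⟩; exact hθ ⟨ρ, hρ⟩) inferInstance
  have hφ0 (ρ : P →ₗ[R] A) : φ (ρ ∘ₗ (LinearMap.ker p).subtype) = 0 := by
    have : φ (res ρ) ∈ (LinearMap.range res).map φ := Submodule.mem_map_of_mem ⟨ρ, rfl⟩
    rwa [hφres, Submodule.mem_bot] at this
  let Φ : (S →ₗ[R] A) →ₗ[K] Module.Dual K (LinearMap.ker p →ₗ[R] S) :=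
    LinearMap.mk₂ K (fun j ξ => φ (j ∘ₗ ξ)) (fun _ _ _ => by rw [LinearMap.add_comp, map_add])
      (fun _ _ _ => by rw [LinearMap.smul_comp, map_smul])
      (fun _ _ _ => by rw [LinearMap.comp_add, map_add])
      (fun c j ξ => by
        rw [← map_smul]; congr 1; ext v
        exact map_smul (j.restrictScalars K) c (ξ v))
  have hΦ : Function.Injective Φ := by
    refine (injective_iff_map_eq_zero Φ).2 fun j hj => by_contra fun hj0 => ?_
    obtain ⟨ξ, ρ, hθ'⟩ := hξ j hj0
    have : φ (j ∘ₗ ξ) = 0 := LinearMap.congr_fun hj ξ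
    exact hφ (by rw [hθ', map_add, this, hφ0, add_zero])
  exact (LinearMap.finrank_le_finrank_of_injective hΦ).trans Subspace.dual_finrank_eq.le

variable [Module K U] [IsScalarTower K R U] [Module K B] [IsScalarTower K R B]

theorem finrank_hom_middle_le (hfg : Function.Exact f g) (hf : Function.Injective f)
    [Module.Finite K S] [Module.Finite K B] [Module.Finite K A] [Module.Finite K U] :
    Module.finrank K (S →ₗ[R] B) ≤
      Module.finrank K (S →ₗ[R] A) + Module.finrank K (S →ₗ[R] U) := by
  have := finite_hom K (R := R) (M := S) (N := A)
  have := finite_hom K (R := R) (M := S) (N := B)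
  have := finite_hom K (R := R) (M := S) (N := U)
  let F : (S →ₗ[R] A) →ₗ[K] (S →ₗ[R] B) := LinearMap.compRight K f
  let G : (S →ₗ[R] B) →ₗ[K] (S →ₗ[R] U) := LinearMap.compRight K g
  have hker : LinearMap.ker G ≤ LinearMap.range F :=
    fun q hq => exists_comp_eq_of_forall_mem_range hf q fun s =>
      (hfg _).1 (LinearMap.congr_fun hq s)
  rw [← G.finrank_range_add_finrank_ker, add_comm]
  exact add_le_add ((Submodule.finrank_mono hker).trans F.finrank_range_le) G.range.finrank_le

theorem IsAlmostSplitSequence.comp_eq_zero_of_isSimpleModule [IsSimpleModule R S]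
    [IsSimpleModule R U] (h : IsAlmostSplitSequence f g) (q : S →ₗ[R] B) : g ∘ₗ q = 0 := by
  by_contra h0
  have hb := LinearMap.bijective_of_ne_zero h0
  refine h.right_almost_split.1 ⟨q ∘ₗ (LinearEquiv.ofBijective _ hb).symm.toLinearMap, ?_⟩
  ext u
  exact (LinearEquiv.ofBijective _ hb).apply_symm_apply u

end AlmostSplit

/-! ### Bounding the top of the kernel -/

section Restriction

variable (K : Type*) {R P S : Type*} [Field K] [Ring R] [Algebra K R]
  [AddCommGroup P] [Module R P] [Module K P] [IsScalarTower K R P]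
  [AddCommGroup S] [Module R S] [Module K S] [IsScalarTower K R S]

theorem exists_extend_sup_of_eq_zero {V W : Submodule R P} (q : V →ₗ[R] S)
    (hq : ∀ v : V, (v : P) ∈ W → q v = 0) :
    ∃ r : ↥(V ⊔ W) →ₗ[R] S, r ∘ₗ Submodule.inclusion le_sup_left = q ∧
      r ∘ₗ Submodule.inclusion le_sup_right = 0 := by
  let a : P →ₗ.[R] S := ⟨V, q⟩
  let b : P →ₗ.[R] S := ⟨W, 0⟩
  have hab (x : a.domain) (y : b.domain) (hxy : (x : P) = y) : a x = b y :=
    hq x (hxy ▸ y.2)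
  refine ⟨(a.sup b hab).toFun, ?_, ?_⟩
  · ext v
    exact ((LinearPMap.left_le_sup a b hab).2 (x := v) rfl).symm
  · ext w
    exact ((LinearPMap.right_le_sup a b hab).2 (x := w) rfl).symm

/-- Restrict to `V ⊓ W i₀`. A map killed by this restriction extends to `V ⊔ W i₀` by zero on `W
i₀`, and the extension is determined on the remaining `W i`. -/
theorem finrank_hom_le_sum_of_sup_eq_iSup [Module.Finite K P] [Module.Finite K S] {ι : Type*}
    [Fintype ι] {V : Submodule R P} (W W' : ι → Submodule R P) (i₀ : ι)
    (hVW : V ⊔ W i₀ = ⨆ i, W i) (h₀ : W' i₀ = V ⊓ W i₀) (h : ∀ i ≠ i₀, W' i = W i) :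
    Module.finrank K (V →ₗ[R] S) ≤ ∑ i, Module.finrank K (W' i →ₗ[R] S) := by
  classical
  have fin (X : Submodule R P) : Module.Finite K (X →ₗ[R] S) :=
    have := finite_submodule K X
    finite_hom K
  let r : (V →ₗ[R] S) →ₗ[K] (↥(V ⊓ W i₀) →ₗ[R] S) :=
    LinearMap.lcomp K S (Submodule.inclusion inf_le_left)
  let a : (↥(V ⊔ W i₀) →ₗ[R] S) →ₗ[K] (V →ₗ[R] S) :=
    LinearMap.lcomp K S (Submodule.inclusion le_sup_left)
  let b : (↥(V ⊔ W i₀) →ₗ[R] S) →ₗ[K] (W i₀ →ₗ[R] S) :=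
    LinearMap.lcomp K S (Submodule.inclusion le_sup_right)
  have hr : LinearMap.ker r ≤ (LinearMap.ker b).map a := by
    intro q hq
    obtain ⟨t, ht, ht'⟩ := exists_extend_sup_of_eq_zero (W := W i₀) q fun v hv =>
      LinearMap.congr_fun hq ⟨v, v.2, hv⟩
    exact ⟨t, ht', ht⟩
  have hWle (i : ι) : W i ≤ V ⊔ W i₀ := hVW ▸ le_iSup W i
  let c : LinearMap.ker b →ₗ[K] (∀ i : {i // i ≠ i₀}, W i →ₗ[R] S) :=
    LinearMap.pi fun i => LinearMap.lcomp K S (Submodule.inclusion (hWle i)) ∘ₗ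
      (LinearMap.ker b).subtype
  have hc : Function.Injective c := by
    refine (injective_iff_map_eq_zero c).2 fun t ht => Subtype.ext ?_
    have hker (i : ι) : W i ≤ (LinearMap.ker t.1).map (V ⊔ W i₀).subtype := by
      intro x hx
      refine ⟨⟨x, hWle i hx⟩, ?_, rfl⟩
      by_cases hi : i = i₀
      · subst hi
        exact LinearMap.congr_fun t.2 ⟨x, hx⟩
      · exact LinearMap.congr_fun (congrFun ht ⟨i, hi⟩) ⟨x, hx⟩
    ext ⟨x, hx⟩
    obtain ⟨y, hy, hyx⟩ := iSup_le hker (hVW ▸ hx)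
    obtain rfl : y = ⟨x, hx⟩ := Subtype.ext hyx
    exact hy
  let d (X : Submodule R P) : ℕ := Module.finrank K (X →ₗ[R] S)
  calc Module.finrank K (V →ₗ[R] S)
      = Module.finrank K (LinearMap.range r) + Module.finrank K (LinearMap.ker r) :=
        r.finrank_range_add_finrank_ker.symm
    _ ≤ d (V ⊓ W i₀) + ∑ i : {i // i ≠ i₀}, d (W i) := by
        refine add_le_add (LinearMap.range r).finrank_le ?_
        refine (Submodule.finrank_mono hr).trans ((Submodule.finrank_map_le _ _).trans ?_)
        exact (LinearMap.finrank_le_finrank_of_injective hc).trans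
          (Module.finrank_pi_fintype K).le
    _ = d (W' i₀) + ∑ i : {i // i ≠ i₀}, d (W' i) := by
        rw [h₀]
        congr 1
        exact Finset.sum_congr rfl fun i _ => by rw [h i i.2]
    _ = ∑ i, d (W' i) := (Fintype.sum_eq_add_sum_subtype_ne (fun i => d (W' i)) i₀).symm

end Restriction

/-! ### Independent families and embeddings into summands -/

section Summands

variable {R : Type u} [Ring R] {U B : Type u} [AddCommGroup U] [Module R U]
  [AddCommGroup B] [Module R B] {g : B →ₗ[R] U}

theorem iSupIndep_option {ι : Type*} [Fintype ι] {N : ι → Submodule R B} (hN : iSupIndep N)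
    {i₀ : ι} {Y Z : Submodule R B} (hYZ : Disjoint Y Z) (hZN : Z ≤ N i₀)
    {σ : Option ι → Submodule R B} (hσ : ∀ i, σ (some i) ≤ N i) (hY : σ (some i₀) ≤ Y)
    (hZ : σ none ≤ Z) : iSupIndep σ := by
  classical
  rw [iSupIndep_iff_finsetSum_eq_zero_imp_eq_zero] at hN ⊢
  intro s v hv hsum
  let v' (o : Option ι) : B := if o ∈ s then v o else 0
  have hv' (o : Option ι) : v' o ∈ σ o := by
    by_cases ho : o ∈ s
    · simpa [v', ho] using hv o ho
    · simp [v', ho]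
  have hsum' : v' none + ∑ i, v' (some i) = 0 := by
    rw [← Fintype.sum_option]
    simpa [v', Finset.sum_ite_mem] using hsum
  -- The extra component is merged into index `i₀`, where disjointness of `Y` and `Z` separates it
  -- again.
  let w (i : ι) : B := v' (some i) + if i = i₀ then v' none else 0
  have hw := hN Finset.univ w
    (fun i _ => by
      refine (N i).add_mem (hσ i (hv' _)) ?_
      split_ifs with hi
      · exact hi ▸ hZN (hZ (hv' none))
      · exact (N i).zero_mem)
    (by simp only [w, Finset.sum_add_distrib, Finset.sum_ite_eq', Finset.mem_univ, if_true]
        rw [add_comm]; exact hsum')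
  have hi₀ : v' (some i₀) + v' none = 0 := by simpa [w] using hw i₀ (Finset.mem_univ _)
  have hnone : v' none = 0 := by
    refine Submodule.disjoint_def.1 hYZ _ ?_ (hZ (hv' none))
    rw [← neg_eq_of_add_eq_zero_right hi₀]
    exact Y.neg_mem (hY (hv' _))
  have hall (o : Option ι) : v' o = 0 := by
    cases o with
    | none => exact hnone
    | some i => simpa [w, hnone] using hw i (Finset.mem_univ _)
  intro o ho
  simpa [v', ho] using hall o

/-- A nonsplit epimorphism onto `U` with simple kernel embeds its source into a summand of the
middle term of an almost split sequence ending in `U`. -/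
theorem IsRightAlmostSplit.exists_injective_to_summand [IsArtinianRing R]
    (hg : IsRightAlmostSplit g) (hU : HasTotalSubmodules R U) [Nontrivial U]
    {ι : Type*} [Fintype ι] [DecidableEq ι] {N : ι → Submodule R B} (hN : DirectSum.IsInternal N)
    {Q : Type u} [AddCommGroup Q] [Module R Q] [Module.Finite R Q] {h : Q →ₗ[R] U}
    (hsurj : Function.Surjective h) (hker : IsSimpleModule R (LinearMap.ker h))
    (hsplit : ¬ ∃ s : U →ₗ[R] Q, h ∘ₗ s = LinearMap.id) :
    ∃ i, ∃ q : Q →ₗ[R] N i, Function.Injective q := by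
  have : Module.Finite R U := Module.Finite.of_surjective h hsurj
  obtain ⟨k, hk⟩ := hg.2 Q h hsplit
  let E := LinearEquiv.ofBijective (DirectSum.coeLinearMap N) hN
  let q (i : ι) : Q →ₗ[R] N i := DirectSum.component R ι (fun i => N i) i ∘ₗ E.symm.toLinearMap ∘ₗ k
  let t (i : ι) : Q →ₗ[R] U := g ∘ₗ (N i).subtype ∘ₗ q i
  have hsum (x : Q) : h x = ∑ i, t i x := by
    have h1 : k x = ∑ i, (q i x : B) := by
      classical
      have h2 : k x = E (E.symm (k x)) := (E.apply_symm_apply _).symm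
      rw [h2]
      exact DirectSum.coeLinearMap_eq_dfinsuppSum N (E.symm (k x)) |>.trans
        (DFinsupp.sum_eq_sum_fintype _ (by simp))
    rw [← hk, LinearMap.comp_apply, h1, map_sum]
    rfl
  have : Nonempty ι := by
    by_contra hι
    rw [not_nonempty_iff] at hι
    obtain ⟨u, hu⟩ := exists_ne (0 : U)
    obtain ⟨x, rfl⟩ := hsurj u
    exact hu (by rw [hsum]; simp)
  -- The components sum to the surjection `h`; since `U` is a chain, the largest image is all of
  -- `U`.
  obtain ⟨i, hi⟩ := hU.exists_forall_le fun i => LinearMap.range (t i)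
  have hti : Function.Surjective (t i) := by
    intro u
    obtain ⟨x, rfl⟩ := hsurj u
    rw [hsum]
    exact Submodule.sum_mem _ fun j _ => hi j ⟨x, rfl⟩
  have hsimple : IsSimpleModule R (LinearMap.ker (t i)) := by
    rw [← Module.length_eq_one_iff] at hker ⊢
    have h1 := Module.length_eq_add_of_exact (LinearMap.ker h).subtype h
      (Submodule.subtype_injective _) hsurj (LinearMap.exact_subtype_ker_map h)
    have h2 := Module.length_eq_add_of_exact (LinearMap.ker (t i)).subtype (t i)
      (Submodule.subtype_injective _) hti (LinearMap.exact_subtype_ker_map (t i))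
    rw [h1, hker] at h2
    exact ENat.add_left_injective_of_ne_top Module.length_ne_top h2.symm
  refine ⟨i, q i, ?_⟩
  rw [← LinearMap.ker_eq_bot]
  have hle : LinearMap.ker (q i) ≤ LinearMap.ker (t i) := fun x hx => by
    have hx : q i x = 0 := hx
    simp [t, hx]
  -- The kernel of `q i` is zero or all of `ker (t i)`; in the latter case `q i` factors through `U`
  -- and splits `g`.
  refine ((isSimpleModule_iff_isAtom.1 hsimple).le_iff.1 hle).resolve_right fun heq => ?_
  refine hg.1 ⟨(N i).subtype ∘ₗ (LinearMap.ker (t i)).liftQ (q i) heq.ge ∘ₗ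
    ((t i).quotKerEquivOfSurjective hti).symm.toLinearMap, ?_⟩
  ext u
  obtain ⟨x, rfl⟩ := hti u
  have : ((t i).quotKerEquivOfSurjective hti).symm (t i x) = (LinearMap.ker (t i)).mkQ x := by
    rw [LinearEquiv.symm_apply_eq]; simp
  simp only [LinearMap.comp_apply, LinearEquiv.coe_coe]
  rw [this]
  rfl

end Summands

/-! ### Counting simples in the middle term -/

section Count

variable (K : Type*) {R : Type u} [Field K] [Ring R] [Algebra K R]
  {P U A B : Type u} [AddCommGroup P] [Module R P] [AddCommGroup U] [Module R U]
  [AddCommGroup A] [Module R A] [AddCommGroup B] [Module R B]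
  [Module K P] [IsScalarTower K R P] [Module K A] [IsScalarTower K R A]
  [Module K B] [IsScalarTower K R B] [Module.Finite K P] [Module.Finite K A] [Module.Finite K B]
  [Module.Projective R P] [Module.Finite R A]
  {f : A →ₗ[R] B} {g : B →ₗ[R] U} {p : P →ₗ[R] U}

theorem exists_ne_zero_of_finrank_hom_ne_zero {M N : Type*} [AddCommGroup M] [Module R M]
    [AddCommGroup N] [Module R N] [Module K N] [IsScalarTower K R N]
    (h : Module.finrank K (M →ₗ[R] N) ≠ 0) : ∃ q : M →ₗ[R] N, q ≠ 0 := by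
  by_contra! h0
  have : Subsingleton (M →ₗ[R] N) := ⟨fun a b => by rw [h0 a, h0 b]⟩
  exact h Module.finrank_zero_of_subsingleton

/-- A bound for the number of independent simple submodules of the middle term. -/
theorem IsAlmostSplitSequence.card_le_card_add_one [Module K U] [IsScalarTower K R U]
    [Module.Finite K U] (h : IsAlmostSplitSequence f g)
    (hp : Function.Surjective p) (hU : HasTotalSubmodules R U)
    {κ ι : Type*} [Fintype κ] [Fintype ι] {σ : κ → Submodule R B} (hσ : iSupIndep σ)
    (hsimple : ∀ k, IsSimpleModule R (σ k)) (W : ι → Submodule R P)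
    (hW : ∀ i, HasTotalSubmodules R (W i))
    (hle : ∀ k, Module.finrank K (LinearMap.ker p →ₗ[R] σ k) ≤
      ∑ i, Module.finrank K (W i →ₗ[R] σ k)) :
    Fintype.card κ ≤ Fintype.card ι + 1 := by
  have fin (k : κ) := finite_submodule K (σ k)
  -- The index `none` stands for the socle of `U`.
  rw [← Fintype.card_option]
  refine card_le_card_of_finrank_hom_le K σ hσ hsimple
    (fun k o => o.elim (Module.finrank K (σ k →ₗ[R] U)) fun i => Module.finrank K (W i →ₗ[R] σ k))
    (fun k => ?_) (fun k o => ?_) (fun k k' o hk hk' => ?_)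
  · have h1 := finrank_hom_middle_le K (S := σ k) h.exact h.injective
    have h2 := h.finrank_hom_left_le K (S := σ k) hp
    have h3 := hle k
    simp only [Fintype.sum_option, Option.elim]
    omega
  · cases o with
    | none => exact hU.finrank_hom_from_le K
    | some i => exact (hW i).finrank_hom_to_le K
  · cases o with
    | none =>
      obtain ⟨q, hq⟩ := exists_ne_zero_of_finrank_hom_ne_zero K hk
      obtain ⟨q', hq'⟩ := exists_ne_zero_of_finrank_hom_ne_zero K hk'
      exact hU.nonempty_equiv_of_hom_from hq hq'
    | some i =>
      obtain ⟨q, hq⟩ := exists_ne_zero_of_finrank_hom_ne_zero K hk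
      obtain ⟨q', hq'⟩ := exists_ne_zero_of_finrank_hom_ne_zero K hk'
      exact (hW i).nonempty_equiv_of_hom_to hq hq'

theorem IsAlmostSplitSequence.card_le_card_of_isSimpleModule (h : IsAlmostSplitSequence f g)
    (hp : Function.Surjective p) [IsSimpleModule R U]
    {κ ι : Type*} [Fintype κ] [Fintype ι] {σ : κ → Submodule R B} (hσ : iSupIndep σ)
    (hsimple : ∀ k, IsSimpleModule R (σ k)) (W : ι → Submodule R P)
    (hW : ∀ i, HasTotalSubmodules R (W i))
    (hle : ∀ k, Module.finrank K (LinearMap.ker p →ₗ[R] σ k) ≤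
      ∑ i, Module.finrank K (W i →ₗ[R] σ k)) :
    Fintype.card κ ≤ Fintype.card ι := by
  have fin (k : κ) := finite_submodule K (σ k)
  refine card_le_card_of_finrank_hom_le K σ hσ hsimple
    (fun k i => Module.finrank K (W i →ₗ[R] σ k))
    (fun k => ?_) (fun k i => (hW i).finrank_hom_to_le K) (fun k k' i hk hk' => ?_)
  · refine le_trans ?_ ((h.finrank_hom_left_le K (S := σ k) hp).trans (hle k))
    have := finite_hom K (R := R) (M := σ k) (N := A)
    refine LinearMap.finrank_le_finrank_of_surjective
      (f := (LinearMap.compRight K f : (σ k →ₗ[R] A) →ₗ[K] (σ k →ₗ[R] B))) fun q => ?_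
    exact exists_comp_eq_of_forall_mem_range h.injective q fun s =>
      (h.exact _).1 (LinearMap.congr_fun (h.comp_eq_zero_of_isSimpleModule q) s)
  · obtain ⟨q, hq⟩ := exists_ne_zero_of_finrank_hom_ne_zero K hk
    obtain ⟨q', hq'⟩ := exists_ne_zero_of_finrank_hom_ne_zero K hk'
    exact (hW i).nonempty_equiv_of_hom_to hq hq'

end Count

/-! ### Quotients of a local module -/

section Local

variable {R : Type*} [Ring R] {P U : Type*} [AddCommGroup P] [Module R P]
  [AddCommGroup U] [Module R U] {p : P →ₗ[R] U} {J V' : Submodule R P}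

theorem isAtom_map_mkQ_of_covBy {V : Submodule R P} (h : V' ⋖ V) :
    IsAtom (V.map V'.mkQ) := by
  refine ⟨fun h0 => h.lt.not_ge ?_, fun X hX => ?_⟩
  · rwa [← le_bot_iff, Submodule.map_le_iff_le_comap, ← LinearMap.ker, Submodule.ker_mkQ] at h0
  · have hle : V' ≤ X.comap V'.mkQ := V'.le_comap_mkQ X
    have hlt : X.comap V'.mkQ < V := by
      have := Submodule.comap_strictMono_of_surjective (Submodule.mkQ_surjective V') hX
      rwa [Submodule.comap_map_mkQ, sup_eq_right.2 h.le] at this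
    have heq : X.comap V'.mkQ = V' := (hle.eq_or_lt.resolve_right fun hl => h.2 hl hlt).symm
    rw [← Submodule.map_comap_eq_of_surjective (Submodule.mkQ_surjective V') X, heq]
    simp

/-- The preimage `X` of a complement to `ker p / V'` would be proper, hence inside `J`; but `X` and
`ker p ≤ J` together span `P`. -/
theorem not_split_liftQ_of_lt_ker (hJ : J ≠ ⊤) (hloc : ∀ X : Submodule R P, X ≠ ⊤ → X ≤ J)
    (hker : LinearMap.ker p ≤ J) (hV' : V' < LinearMap.ker p) :
    ¬ ∃ s : U →ₗ[R] P ⧸ V', V'.liftQ p hV'.le ∘ₗ s = LinearMap.id := by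
  rintro ⟨s, hs⟩
  have hs' (x : P) : V'.liftQ p hV'.le (s (p x)) = p x := LinearMap.congr_fun hs (p x)
  let X := (LinearMap.range s).comap V'.mkQ
  have hX : X ≠ ⊤ := by
    intro htop
    obtain ⟨v, hv, hvV'⟩ := SetLike.exists_of_lt hV'
    obtain ⟨u, hu⟩ : v ∈ X := htop ▸ Submodule.mem_top
    have h1 : u = p v := by
      rw [← LinearMap.id_apply (R := R) u, ← hs, LinearMap.comp_apply, hu]; simp
    rw [h1, LinearMap.mem_ker.1 hv, map_zero] at hu
    exact hvV' ((Submodule.Quotient.mk_eq_zero V').1 hu.symm)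
  refine hJ (top_le_iff.1 fun x _ => ?_)
  obtain ⟨y, hy⟩ := V'.mkQ_surjective (s (p x))
  have hyX : y ∈ X := ⟨p x, hy.symm⟩
  have hxy : x - y ∈ LinearMap.ker p := by
    have := hs' x
    rw [← hy] at this
    rw [LinearMap.mem_ker, map_sub, sub_eq_zero, ← this]
    simp
  have := J.add_mem (hker hxy) (hloc X hX hyX)
  rwa [sub_add_cancel] at this

end Local

/-! ### The bound on the number of summands -/

/-- The number of summands of the middle term is at most `m` if the radical of the projective
cover of `U` is a sum of `m` submodules whose submodules are linearly ordered. -/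
theorem IsAlmostSplitSequence.card_summands_le (K : Type*) {R : Type u} [Field K] [Ring R]
    [Algebra K R] [FiniteDimensional K R] {P U A B : Type u} [AddCommGroup P] [Module R P]
    [AddCommGroup U] [Module R U] [AddCommGroup A] [Module R A] [AddCommGroup B] [Module R B]
    [Module.Finite R P] [Module.Finite R U] [Module.Finite R A] [Module.Finite R B]
    [Module.Projective R P] [Nontrivial U] {f : A →ₗ[R] B} {g : B →ₗ[R] U} {p : P →ₗ[R] U}
    (h : IsAlmostSplitSequence f g)
    (hp : Function.Surjective p) (hU : HasTotalSubmodules R U) {J : Submodule R P} (hJ : J ≠ ⊤)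
    (hloc : ∀ X : Submodule R P, X ≠ ⊤ → X ≤ J) {m : ℕ} (hm : 2 ≤ m) (W : Fin m → Submodule R P)
    (hW : ∀ i, HasTotalSubmodules R (W i)) (hWJ : ⨆ i, W i = J)
    {n : ℕ} (N : Fin n → Submodule R B) (hN : DirectSum.IsInternal N) (hN0 : ∀ i, N i ≠ ⊥) :
    n ≤ m := by
  have : IsArtinianRing R := IsArtinianRing.of_finite K R
  let _ : Module K P := Module.compHom P (algebraMap K R)
  have : IsScalarTower K R P := ⟨fun c x y => by rw [Algebra.smul_def, mul_smul]; rfl⟩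
  have : Module.Finite K P := .trans R P
  let _ : Module K U := Module.compHom U (algebraMap K R)
  have : IsScalarTower K R U := ⟨fun c x y => by rw [Algebra.smul_def, mul_smul]; rfl⟩
  have : Module.Finite K U := .trans R U
  let _ : Module K A := Module.compHom A (algebraMap K R)
  have : IsScalarTower K R A := ⟨fun c x y => by rw [Algebra.smul_def, mul_smul]; rfl⟩
  have : Module.Finite K A := .trans R A
  let _ : Module K B := Module.compHom B (algebraMap K R)
  have : IsScalarTower K R B := ⟨fun c x y => by rw [Algebra.smul_def, mul_smul]; rfl⟩
  have : Module.Finite K B := .trans R B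
  have : Nonempty (Fin m) := ⟨⟨0, by omega⟩⟩
  have exists_atom {X : Submodule R B} (hX : X ≠ ⊥) : ∃ σ ≤ X, IsSimpleModule R σ := by
    obtain ⟨σ, hσ, hσX⟩ := (eq_bot_or_exists_atom_le X).resolve_left hX
    exact ⟨σ, hσX, isSimpleModule_iff_isAtom.2 hσ⟩
  have hkertop : LinearMap.ker p ≠ ⊤ := by
    intro htop
    obtain ⟨u, hu⟩ := exists_ne (0 : U)
    obtain ⟨x, rfl⟩ := hp u
    exact hu (LinearMap.mem_ker.1 (htop ▸ Submodule.mem_top))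
  have hker := hloc _ hkertop
  obtain ⟨i₁, hi₁⟩ := hU.exists_forall_le fun i => (W i).map p
  have hsup : LinearMap.ker p ⊔ W i₁ = J := by
    refine le_antisymm (sup_le hker (hWJ ▸ le_iSup W i₁)) (hWJ ▸ iSup_le fun i => ?_)
    have := Submodule.map_le_iff_le_comap.1 (hi₁ i)
    rwa [Submodule.comap_map_eq, sup_comm] at this
  choose σ hσN hσ using fun i => exists_atom (hN0 i)
  have hind : iSupIndep σ := hN.submodule_iSupIndep.mono hσN
  let W' := Function.update W i₁ (LinearMap.ker p ⊓ W i₁)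
  have hW' (i : Fin m) : HasTotalSubmodules R (W' i) := by
    have hle : W' i ≤ W i := by
      by_cases hi : i = i₁
      · subst hi
        simp [W']
      · simp [W', hi]
    exact (hW i).of_injective (Submodule.inclusion hle) (Submodule.inclusion_injective hle)
  have hsum (S : Submodule R B) : Module.finrank K (LinearMap.ker p →ₗ[R] S) ≤
      ∑ i, Module.finrank K (W' i →ₗ[R] S) := by
    have := finite_submodule K S
    exact finrank_hom_le_sum_of_sup_eq_iSup K W W' i₁ (hsup.trans hWJ.symm) (by simp [W'])
      fun i hi => by simp [W', hi]
  by_cases hUs : IsSimpleModule R U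
  · simpa using h.card_le_card_of_isSimpleModule K hp hind hσ W' hW' fun k => hsum (σ k)
  by_cases hle : LinearMap.ker p ≤ W i₁
  · have := h.card_le_card_add_one K hp hU hind hσ (fun _ : Unit => LinearMap.ker p)
      (fun _ => (hW i₁).of_injective _ (Submodule.inclusion_injective hle)) fun k => by simp
    simp only [Fintype.card_fin, Fintype.card_unit] at this
    omega
  obtain ⟨V', hV'le, hV'⟩ := exists_le_covBy_of_lt (inf_lt_left.2 hle)
  have hmap : LinearMap.ker (V'.liftQ p hV'.le) = (LinearMap.ker p).map V'.mkQ :=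
    Submodule.ker_liftQ _ _ _
  have hsimple : IsSimpleModule R (LinearMap.ker (V'.liftQ p hV'.le)) := by
    rw [hmap]
    exact isSimpleModule_iff_isAtom.2 (isAtom_map_mkQ_of_covBy hV')
  obtain ⟨i₀, q, hq⟩ := h.right_almost_split.exists_injective_to_summand hU hN
    (h := V'.liftQ p hV'.le)
    (fun u => (hp u).imp' V'.mkQ fun x hx => by simpa using hx) hsimple
    (not_split_liftQ_of_lt_ker hJ hloc hker hV'.lt)
  let q' : (P ⧸ V') →ₗ[R] B := (N i₀).subtype ∘ₗ q
  have hq' : Function.Injective q' := (N i₀).subtype_injective.comp hq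
  have hq'N (X : Submodule R (P ⧸ V')) : X.map q' ≤ N i₀ := by
    rintro _ ⟨x, -, rfl⟩
    exact (q x).2
  have hne (X : Submodule R P) (hX : ¬ X ≤ V') : (X.map V'.mkQ).map q' ≠ ⊥ := by
    intro h0
    rw [← Submodule.map_bot q'] at h0
    have := Submodule.map_injective_of_injective hq' h0
    rw [← le_bot_iff, Submodule.map_le_iff_le_comap, ← LinearMap.ker, Submodule.ker_mkQ] at this
    exact hX this
  -- Otherwise `ker p = J` would be maximal and `U` simple.
  have hWV' : ¬ W i₁ ≤ V' := by
    intro hWV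
    refine hUs ?_
    have hkerJ : LinearMap.ker p = J := by rw [← hsup, sup_eq_left.2 (hWV.trans hV'.le)]
    have hco : IsCoatom (LinearMap.ker p) :=
      ⟨hkertop, fun X hX => by_contra fun hXt => hX.not_ge (hkerJ ▸ hloc X hXt)⟩
    have := isSimpleModule_iff_isCoatom.2 hco
    exact .congr (p.quotKerEquivOfSurjective hp).symm
  have hdisj : Disjoint ((W i₁).map V'.mkQ) ((LinearMap.ker p).map V'.mkQ) := by
    rw [Submodule.disjoint_def]
    rintro _ ⟨w, hw, rfl⟩ ⟨v, hv, hvw⟩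
    have hmem : v - w ∈ V' := (Submodule.Quotient.eq V').1 hvw
    have hwk : w ∈ LinearMap.ker p := by
      have := (LinearMap.ker p).sub_mem hv (hV'.le hmem)
      rwa [sub_sub_cancel] at this
    exact (Submodule.Quotient.mk_eq_zero V').2 (hV'le ⟨hwk, hw⟩)
  obtain ⟨Y, hYle, hY⟩ := exists_atom (hne _ hWV')
  obtain ⟨Z, hZle, hZ⟩ := exists_atom (hne _ hV'.lt.not_ge)
  let τ : Option (Fin n) → Submodule R B := fun o => o.elim Z (Function.update σ i₀ Y)
  have hτ : iSupIndep τ := by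
    refine iSupIndep_option hN.submodule_iSupIndep (i₀ := i₀) (Submodule.disjoint_map hq' hdisj)
      (hq'N _) (fun i => ?_) (by simpa [τ] using hYle) hZle
    by_cases hi : i = i₀
    · subst hi
      simpa [τ] using hYle.trans (hq'N _)
    · simpa [τ, hi] using hσN i
  have hτs (o : Option (Fin n)) : IsSimpleModule R (τ o) := by
    cases o with
    | none => exact hZ
    | some i =>
      by_cases hi : i = i₀
      · subst hi
        rwa [show τ (some i) = Y from Function.update_self ..]
      · rw [show τ (some i) = σ i from Function.update_of_ne hi ..]
        exact hσ i
  simpa using h.card_le_card_add_one K hp hU hτ hτs W' hW' fun k => hsum (τ k)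

theorem mainTheorem1 {K : Type*} {Λ : Type u} [Field K] [Ring Λ] [Algebra K Λ]
    [FiniteDimensional K Λ] (m : ℕ) (hm : 2 ≤ m) (hΛ : IsLeftMultiserial m Λ)
    (U : Type u) [AddCommGroup U] [Module Λ U] [Module.Finite Λ U]
    (hU : IsUniserialModule Λ U) (hproj : ¬ Module.Projective Λ U)
    (A B : Type u) [AddCommGroup A] [Module Λ A] [Module.Finite Λ A]
    [AddCommGroup B] [Module Λ B] [Module.Finite Λ B]
    (f : A →ₗ[Λ] B) (g : B →ₗ[Λ] U) (hfg : IsAlmostSplitSequence f g)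
    (n : ℕ) (N : Fin n → Submodule Λ B) (hN : DirectSum.IsInternal N)
    (hind : ∀ i, IsIndecomposableModule Λ (N i)) :
    n ≤ m := by
  have : IsArtinianRing Λ := IsArtinianRing.of_finite K Λ
  have : Nontrivial U := by
    by_contra h
    rw [not_nontrivial_iff_subsingleton] at h
    exact hproj inferInstance
  obtain ⟨e, he, p, hp⟩ := hU.hasTotalSubmodules.exists_isPrimitiveIdempotent_surjective
  obtain ⟨V, hV, hVJ⟩ := hΛ e he
  have := he.2.1.projective_span_singleton
  let P : Submodule Λ Λ := Submodule.span Λ {e}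
  have hJP : radicalMul e ≤ P := by
    rintro _ ⟨x, -, rfl⟩
    exact Submodule.mem_span_singleton.2 ⟨x, rfl⟩
  have hVP (i : Fin m) : V i ≤ P := (hVJ ▸ le_iSup V i).trans hJP
  have heJ : e ∉ radicalMul e := by
    rintro ⟨x, hx, hxe⟩
    rw [← Ideal.jacobson_bot] at hx
    -- With `-1`, `z` is a left inverse of `1 - x`, which annihilates `e`.
    obtain ⟨z, hz⟩ := Ideal.mem_jacobson_iff.1 hx (-1)
    have hxe' : x * e = e := hxe
    have h1 : z * -1 * x + z = 1 := sub_eq_zero.1 hz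
    refine he.1 ?_
    rw [← one_mul e, ← h1, add_mul, mul_assoc, hxe']
    simp
  refine hfg.card_summands_le K hp hU.hasTotalSubmodules (J := (radicalMul e).comap P.subtype)
    ?_ ?_ hm (fun i => (V i).comap P.subtype) ?_ ?_ N hN fun i => ?_
  · intro htop
    exact heJ (show (⟨e, Submodule.mem_span_singleton_self e⟩ : P) ∈
      (radicalMul e).comap P.subtype from htop ▸ Submodule.mem_top)
  · intro X hX
    rw [← Submodule.map_le_iff_le_comap]
    by_contra hXJ
    obtain ⟨y, hy, hye⟩ := he.mem_of_not_le_radicalMul (Submodule.map_subtype_le P X) hXJ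
    refine hX (top_le_iff.1 ?_)
    rintro ⟨x, hx⟩ -
    obtain ⟨c, rfl⟩ := Submodule.mem_span_singleton.1 hx
    have : (⟨c • e, hx⟩ : P) = c • y := Subtype.ext (by simp [← hye])
    rw [this]
    exact X.smul_mem c hy
  · exact fun i => (hV i).hasTotalSubmodules.of_injective
      (Submodule.comapSubtypeEquivOfLe (hVP i)).toLinearMap (LinearEquiv.injective _)
  · refine Submodule.map_injective_of_injective P.subtype_injective ?_
    rw [Submodule.map_iSup, Submodule.map_comap_subtype, inf_eq_right.2 hJP, ← hVJ]
    exact iSup_congr fun i => by rw [Submodule.map_comap_subtype, inf_eq_right.2 (hVP i)]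
  · exact (Submodule.nontrivial_iff_ne_bot).1 (hind i).1
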